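/- Write $\mathbb I=[0,1]$ and let $\lambda$ be Lebesgue measure. A $d$-dimensional copula is a function $C:\mathbb I^d\to\mathbb I$ of the form $C(\mathbf u)=\mu_C([\mathbf 0,\mathbf u])$ for a (necessarily unique) Borel probability measure $\mu_C$ on $\mathbb I^d$ all of whose one-dimensional marginals are $\lambda$ on $\mathbb I$; $\mathcal C^d$ denotes the set of all $d$-dimensional copulas, endowed with the total variation metric $$TV(C_1,C_2)=\sup_{G\in\mathcal B(\mathbb I^d)}|\mu_{C_1}(G)-\mu_{C_2}(G)|.$$ For $C\in\mathcal C^3$ let $K_C$ be a regular conditional distribution under $\mu_C$ of the first two coordinates given the third, and put $F_{1|3}(u|t)=K_C(t,[0,u]\times\mathbb I)$ and $F_{2|3}(u|t)=K_C(t,\mathbb I\times[0,u])$. The copula $C$ is called simplified if $F_{1|3}(\cdot|t)$ and $F_{2|3}(\cdot|t)$ are continuous for $\lambda$-almost every $t\in\mathbb I$ and there is a bivariate copula $A\in\mathcal C^2$ such that $$C(u_1,u_2,v)=\int_{[0,v]}A\big(F_{1|3}(u_1|t),F_{2|3}(u_2|t)\big)\,\mathrm d\lambda(t)\qquad\text{for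 all }u_1,u_2,v\in\mathbb I.$$ Let $\mathcal C^3_{\mathrm{ac},>0}$ be the set of all $C\in\mathcal C^3$ for which $\mu_C$ is absolutely continuous with respect to $\lambda^3$ with a density that is positive $\lambda^3$-almost everywhere. Theorem. (1) The set of all simplified copulas is nowhere dense in $(\mathcal C^3,TV)$. (2) The set of all simplified copulas in $\mathcal C^3_{\mathrm{ac},>0}$ is nowhere dense in the metric space $(\mathcal C^3_{\mathrm{ac},>0},TV)$. -/

import Mathlib

open MeasureTheory ProbabilityTheory Set unitInterval

/-- A `d`-dimensional copula: a function on the unit cube `I ^ d` that is the distribution function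
`u ↦ μ [0, u]` of a probability measure `μ` on the cube all of whose one-dimensional marginals are
uniform on `I = [0, 1]` (`volume` on `I` is Lebesgue measure, and `Iic u` is the box `[0, u]`). -/
structure Copula (d : ℕ) where
  toFun : (Fin d → I) → ℝ
  exists_measure : ∃ μ : Measure (Fin d → I), IsProbabilityMeasure μ ∧
    (∀ i, μ.map (fun x => x i) = volume) ∧ ∀ u, toFun u = μ.real (Iic u)

namespace Copula

variable {d : ℕ}

instance : CoeFun (Copula d) (fun _ => (Fin d → I) → ℝ) := ⟨Copula.toFun⟩

/-- The `d`-stochastic measure `μ_C` of a copula `C`. -/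
noncomputable def measure (C : Copula d) : Measure (Fin d → I) := C.exists_measure.choose

instance (C : Copula d) : IsProbabilityMeasure C.measure := C.exists_measure.choose_spec.1

theorem map_measure (C : Copula d) (i : Fin d) : C.measure.map (fun x => x i) = volume :=
  C.exists_measure.choose_spec.2.1 i

theorem apply_eq (C : Copula d) (u : Fin d → I) : C u = C.measure.real (Iic u) :=
  C.exists_measure.choose_spec.2.2 u

/-- The measure `μ_C` is the only probability measure whose distribution function is `C`. -/
theorem measure_eq (C : Copula d) (μ : Measure (Fin d → I)) [IsProbabilityMeasure μ]
    (h : ∀ u, C u = μ.real (Iic u)) : C.measure = μ := by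
  have hgen : (MeasurableSpace.pi : MeasurableSpace (Fin d → I)) =
      MeasurableSpace.generateFrom (Set.pi univ '' Set.pi univ fun _ => range Iic) := by
    refine (generateFrom_eq_pi (fun _ => ?_) fun _ => ?_).symm
    · rw [← borel_eq_generateFrom_Iic]
      exact (BorelSpace.measurable_eq (α := I)).symm
    · exact ⟨fun _ => Iic 1, fun _ => ⟨1, rfl⟩, by
        ext x; simpa using unitInterval.le_one'⟩
  refine ext_of_generate_finite _ hgen (IsPiSystem.pi fun _ => ?_) ?_ (by simp)
  · rw [← image_univ]; exact isPiSystem_image_Iic univ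
  rintro _ ⟨s, hs, rfl⟩
  choose u hu using fun i => hs i (mem_univ i)
  have hbox : Set.pi univ s = Iic u := by
    rw [← Set.pi_univ_Iic]; exact congrArg _ (funext fun i => (hu i).symm)
  rw [hbox, ← measureReal_eq_measureReal_iff, ← C.apply_eq, h]

/-- The total variation distance of two copulas: the supremum of `|μ_C G - μ_D G|` over all Borel
sets `G` of the cube. -/
noncomputable def tv (C D : Copula d) : ℝ :=
  ⨆ G : {G : Set (Fin d → I) // MeasurableSet G}, |C.measure.real G - D.measure.real G|

theorem le_tv (C D : Copula d) {G : Set (Fin d → I)} (hG : MeasurableSet G) :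
    |C.measure.real G - D.measure.real G| ≤ C.tv D := by
  refine le_ciSup
    (f := fun G : {G : Set (Fin d → I) // MeasurableSet G} =>
      |C.measure.real G - D.measure.real G|) ⟨1, ?_⟩ ⟨G, hG⟩
  rintro _ ⟨G, rfl⟩
  have h1 := measureReal_nonneg (μ := C.measure) (s := G.1)
  have h2 := measureReal_le_one (μ := C.measure) (s := G.1)
  have h3 := measureReal_nonneg (μ := D.measure) (s := G.1)
  have h4 := measureReal_le_one (μ := D.measure) (s := G.1)
  exact abs_le.2 ⟨by linarith, by linarith⟩

/-- The family of all `d`-dimensional copulas is a metric space under total variation. -/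
noncomputable instance instMetricSpaceTV : MetricSpace (Copula d) where
  dist := tv
  dist_self C := by simp [tv]
  dist_comm C D := by simp only [tv, abs_sub_comm]
  dist_triangle C D E := by
    have : Nonempty {G : Set (Fin d → I) // MeasurableSet G} := ⟨⟨∅, MeasurableSet.empty⟩⟩
    refine ciSup_le fun G => ?_
    exact (abs_sub_le _ (D.measure.real G) _).trans
      (add_le_add (le_tv C D G.2) (le_tv D E G.2))
  eq_of_dist_eq_zero := by
    intro C D h
    have key : C.toFun = D.toFun := by
      funext u
      have h1 := le_tv C D (measurableSet_Iic (a := u))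
      rw [show C.tv D = 0 from h] at h1
      rw [C.apply_eq, D.apply_eq]
      exact sub_eq_zero.1 (abs_eq_zero.1 (le_antisymm h1 (abs_nonneg _)))
    cases C; cases D; cases key; rfl

/-- A Markov kernel `K_C` of `C`: a regular conditional distribution, under `μ_C`, of the first
`d` coordinates given the last one. -/
noncomputable def kernel (C : Copula (d + 1)) : Kernel I (Fin d → I) :=
  condDistrib (fun x i => x i.castSucc) (fun x => x (Fin.last d)) C.measure

instance (C : Copula (d + 1)) : IsMarkovKernel C.kernel := by
  unfold kernel; infer_instance

/-- The conditional univariate distribution function of coordinate `i` given that the last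
coordinate equals `t`, evaluated at `u`. -/
noncomputable def condCDF (C : Copula (d + 1)) (i : Fin d) (u t : I) : I :=
  ⟨(C.kernel t).real {x | x i ≤ u}, measureReal_nonneg, measureReal_le_one⟩

/-- `C` is generalized simplified with respect to the third coordinate: the conditional copulas of
the first two coordinates given the third one can be chosen independently of the condition. -/
def IsGeneralizedSimplified (C : Copula 3) : Prop :=
  ∃ A : Copula 2, ∀ u₁ u₂ v : I,
    C ![u₁, u₂, v] = ∫ t in Iic v, A ![C.condCDF 0 u₁ t, C.condCDF 1 u₂ t]

/-- Almost all conditional univariate distribution functions of `C` are continuous. -/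
def HasContinuousCondMargins (C : Copula 3) : Prop :=
  ∀ᵐ t : I, ∀ i, Continuous fun u => C.condCDF i u t

/-- `C` is simplified: generalized simplified with continuous conditional margins. -/
def IsSimplified (C : Copula 3) : Prop :=
  C.IsGeneralizedSimplified ∧ C.HasContinuousCondMargins

/-- `C` is absolutely continuous with an (almost everywhere) positive Lebesgue density. -/
def HasPositiveDensity (C : Copula d) : Prop :=
  ∃ c : (Fin d → I) → ℝ, Measurable c ∧ (∀ᵐ x, 0 < c x) ∧
    C.measure = volume.withDensity fun x => ENNReal.ofReal (c x)

end Copula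

/-! A bivariate copula `A` is 1-Lipschitz for the `ℓ¹` distance. Hence a simplified `C` satisfies,
for fixed `u`, `v` and almost every pair `(t, s)`, `|K_C(t,[0,u]) - K_C(s,[0,v])| ≤ ∑ i, |F_i(u_i|t)
- F_i(v_i|s)|`, an inequality in which `A` no longer occurs. Total variation controls the `L¹`
distance of kernel values, so the inequality survives in the closure
(`ae_abs_kernel_sub_le_of_mem_closure`).

It remains to leave the closure from any simplified `C` by an arbitrarily small step. Mix `C` with
weight `δ` with a copula `block h`, whose conditional margins are uniform for every `h` while its
conditional dependence is governed by `h t`. The mixtures for `h = 0` and for `h` the indicator of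
`(1/2, 1]` have the same conditional margins, but for `s > 1/2` their kernels on `[0,1/2]²` differ
by `δ/4`. For `t ≤ 1/2 < s`, continuity of the margins at `t` gives `a`, `b` making the right-hand
side less than `δ/8`; the inequality cannot hold for both mixtures
(`exists_mix_block_notMem_closure`). Since `block h` has a density, mixing also preserves positivity
of the density, which gives the second claim. -/

namespace Copula

variable {d : ℕ}

/-! ### Kernels and total variation -/

theorem measurable_kernel_real (C : Copula (d + 1)) {R : Set (Fin d → I)} (hR : MeasurableSet R) :
    Measurable fun t => (C.kernel t).real R :=
  (C.kernel.measurable_coe hR).ennreal_toReal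

theorem integrable_kernel_real (C : Copula (d + 1)) {R : Set (Fin d → I)}
    (hR : MeasurableSet R) : Integrable fun t => (C.kernel t).real R :=
  Integrable.of_bound (C.measurable_kernel_real hR).aestronglyMeasurable 1 <|
    .of_forall fun t => by
      rw [Real.norm_of_nonneg measureReal_nonneg]; exact measureReal_le_one

/-- The disintegration of `μ_C` with respect to the last coordinate. -/
theorem setIntegral_kernel_real (C : Copula (d + 1)) {R : Set (Fin d → I)}
    (hR : MeasurableSet R) {T : Set I} (hT : MeasurableSet T) :
    ∫ t in T, (C.kernel t).real R =
      C.measure.real {x | (fun i : Fin d => x i.castSucc) ∈ R ∧ x (Fin.last d) ∈ T} := by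
  have hX : Measurable fun x : Fin (d + 1) → I => x (Fin.last d) := measurable_pi_apply _
  have hY : Measurable fun (x : Fin (d + 1) → I) (i : Fin d) => x i.castSucc :=
    measurable_pi_lambda _ fun i => measurable_pi_apply _
  have h := setLIntegral_preimage_condDistrib (μ := C.measure) hX hY.aemeasurable hR hT
  rw [← setLIntegral_map hT (Kernel.measurable_coe _ hR) hX, C.map_measure] at h
  simp only [measureReal_def]
  rw [integral_toReal (C.kernel.measurable_coe hR).aemeasurable
    (.of_forall fun _ => measure_lt_top _ _)]
  rw [inter_comm] at h
  exact congrArg ENNReal.toReal h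

/-- The difference of kernel values integrates over `T` to `μ_C(R × T) - μ_D(R × T)`. Taking for `T`
the set where the difference is nonnegative, and its complement, costs one distance each. -/
theorem integral_abs_kernel_real_sub_le (C D : Copula (d + 1)) {R : Set (Fin d → I)}
    (hR : MeasurableSet R) :
    ∫ t, |(C.kernel t).real R - (D.kernel t).real R| ≤ 2 * dist C D := by
  set f : I → ℝ := fun t => (C.kernel t).real R - (D.kernel t).real R with hf
  have hfm : Measurable f := (C.measurable_kernel_real hR).sub (D.measurable_kernel_real hR)
  have hfi : Integrable f := (C.integrable_kernel_real hR).sub (D.integrable_kernel_real hR)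
  have key : ∀ T : Set I, MeasurableSet T → |∫ t in T, f t| ≤ dist C D := by
    intro T hT
    rw [hf, integral_sub (C.integrable_kernel_real hR).integrableOn
      (D.integrable_kernel_real hR).integrableOn, C.setIntegral_kernel_real hR hT,
      D.setIntegral_kernel_real hR hT]
    refine C.le_tv D ?_
    exact (hR.preimage (measurable_pi_lambda (fun (x : Fin (d + 1) → I) (i : Fin d) =>
      x i.castSucc) fun i => measurable_pi_apply _)).inter
      (hT.preimage (measurable_pi_apply (Fin.last d)))
  have hT : MeasurableSet {t | 0 ≤ f t} := measurableSet_le measurable_const hfm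
  have h1 := abs_le.1 (key _ hT)
  have h2 := abs_le.1 (key _ hT.compl)
  rw [← integral_add_compl hT hfi.abs,
    setIntegral_congr_fun (g := f) hT fun t ht => abs_of_nonneg ht,
    setIntegral_congr_fun (g := fun t => -f t) hT.compl
      fun t (ht : ¬ 0 ≤ f t) => abs_of_nonpos (not_le.1 ht).le, integral_neg]
  linarith

/-! ### Lipschitz continuity of copulas -/

/-- The part of `[0,u]` outside `[0,v]` is covered by the slabs `v i < x i ≤ u i`, whose masses are
read off from the uniform margins. -/
theorem sub_le_sum_abs (A : Copula d) (u v : Fin d → I) :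
    A u - A v ≤ ∑ i, |(u i : ℝ) - v i| := by
  have hsub : Iic u ⊆ Iic v ∪ ⋃ i, {x : Fin d → I | x i ∈ Ioc (v i) (u i)} := by
    intro x hx
    by_cases h : x ≤ v
    · exact Or.inl h
    · rw [Pi.le_def] at h
      push Not at h
      obtain ⟨i, hi⟩ := h
      exact Or.inr (mem_iUnion.2 ⟨i, hi, hx i⟩)
  have hi : ∀ i, A.measure.real {x : Fin d → I | x i ∈ Ioc (v i) (u i)} ≤ |(u i : ℝ) - v i| := by
    intro i
    have h := congrArg (fun μ : Measure I => μ.real (Ioc (v i) (u i))) (A.map_measure i)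
    rw [map_measureReal_apply (measurable_pi_apply i) measurableSet_Ioc] at h
    change A.measure.real ((fun x : Fin d → I => x i) ⁻¹' Ioc (v i) (u i)) ≤ _
    rw [h, measureReal_def, volume_Ioc, ENNReal.toReal_ofReal']
    exact max_le (le_abs_self _) (abs_nonneg _)
  rw [A.apply_eq, A.apply_eq, sub_le_iff_le_add']
  calc A.measure.real (Iic u) ≤ _ := measureReal_mono hsub
    _ ≤ _ := measureReal_union_le _ _
    _ ≤ _ := by
      gcongr
      exact (measureReal_iUnion_fintype_le _).trans (Finset.sum_le_sum fun i _ => hi i)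

/-- Copulas are Lipschitz continuous with constant one for the `ℓ¹` distance. -/
theorem abs_sub_le_sum_abs (A : Copula d) (u v : Fin d → I) :
    |A u - A v| ≤ ∑ i, |(u i : ℝ) - v i| := by
  refine abs_le.2 ⟨?_, A.sub_le_sum_abs u v⟩
  have h := A.sub_le_sum_abs v u
  simp only [abs_sub_comm (v _ : ℝ)] at h
  linarith

theorem continuous_coe (A : Copula d) : Continuous A := by
  rw [continuous_iff_continuousAt]
  intro v
  have h : Filter.Tendsto (fun u : Fin d → I => ∑ i, |(u i : ℝ) - v i|) (nhds v) (nhds 0) := by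
    have : Continuous fun u : Fin d → I => ∑ i, |(u i : ℝ) - v i| := by fun_prop
    simpa using this.tendsto v
  exact tendsto_iff_dist_tendsto_zero.2
    (squeeze_zero (fun _ => dist_nonneg) (fun u => A.abs_sub_le_sum_abs u v) h)

end Copula

/-- The finite measures with densities `f` and `g` have the same distribution function, so they
agree, and so do their densities. -/
theorem ae_eq_of_setIntegral_Iic_eq {f g : I → ℝ} (hf : Integrable f) (hg : Integrable g)
    (hf0 : ∀ t, 0 ≤ f t) (hg0 : ∀ t, 0 ≤ g t)
    (h : ∀ v, ∫ t in Iic v, f t = ∫ t in Iic v, g t) : f =ᵐ[volume] g := by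
  have hfin : ∀ k : I → ℝ, Integrable k →
      IsFiniteMeasure (volume.withDensity fun t => ENNReal.ofReal (k t)) := fun k hk =>
    isFiniteMeasure_withDensity_ofReal hk.2
  have := hfin f hf
  have := hfin g hg
  have heq : (volume.withDensity fun t => ENNReal.ofReal (f t)) =
      volume.withDensity fun t => ENNReal.ofReal (g t) := by
    refine Measure.ext_of_Iic _ _ fun v => ?_
    rw [withDensity_apply _ measurableSet_Iic, withDensity_apply _ measurableSet_Iic,
      ← ofReal_integral_eq_lintegral_ofReal hf.integrableOn (.of_forall hf0),
      ← ofReal_integral_eq_lintegral_ofReal hg.integrableOn (.of_forall hg0), h]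
  have := (withDensity_eq_iff hf.aemeasurable.ennreal_ofReal hg.aemeasurable.ennreal_ofReal
    (by rw [← ofReal_integral_eq_lintegral_ofReal hf (.of_forall hf0)]
        exact ENNReal.ofReal_ne_top)).1 heq
  filter_upwards [this] with t ht
  exact (ENNReal.ofReal_eq_ofReal_iff (hf0 t) (hg0 t)).1 ht

namespace Copula

variable {d : ℕ}

/-- Kernel values are determined almost everywhere by the measures of the boxes `R × [0, v]`. -/
theorem kernel_real_ae_eq (C : Copula (d + 1)) {R : Set (Fin d → I)} (hR : MeasurableSet R)
    {f : I → ℝ} (hf : Integrable f) (hf0 : ∀ t, 0 ≤ f t)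
    (h : ∀ v, C.measure.real {x | (fun i : Fin d => x i.castSucc) ∈ R ∧ x (Fin.last d) ≤ v} =
      ∫ t in Iic v, f t) : ∀ᵐ t : I, (C.kernel t).real R = f t :=
  ae_eq_of_setIntegral_Iic_eq (C.integrable_kernel_real hR) hf (fun _ => measureReal_nonneg) hf0
    fun v => (C.setIntegral_kernel_real hR measurableSet_Iic).trans (h v)

theorem measurable_condCDF (C : Copula (d + 1)) (i : Fin d) (u : I) :
    Measurable (C.condCDF i u) :=
  (C.measurable_kernel_real (measurableSet_le (measurable_pi_apply i) measurable_const)).subtype_mk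

/-! ### An inequality stable under total variation limits -/

/-- Disintegrated form of the defining equation, obtained by comparing integrands in `v`. The
exceptional null set may depend on `u`. -/
theorem IsGeneralizedSimplified.exists_copula {C : Copula 3} (hC : C.IsGeneralizedSimplified) :
    ∃ A : Copula 2, ∀ u : Fin 2 → I, ∀ᵐ t : I,
      (C.kernel t).real (Iic u) = A ![C.condCDF 0 (u 0) t, C.condCDF 1 (u 1) t] := by
  obtain ⟨A, hA⟩ := hC
  refine ⟨A, fun u => ?_⟩
  have h0 : ∀ w, 0 ≤ A w := fun w => by rw [A.apply_eq]; exact measureReal_nonneg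
  have h1 : ∀ w, A w ≤ 1 := fun w => by rw [A.apply_eq]; exact measureReal_le_one
  refine C.kernel_real_ae_eq measurableSet_Iic (.of_bound (C := 1) ?_ ?_) (fun t => h0 _) ?_
  · refine (A.continuous_coe.measurable.comp (measurable_pi_lambda _ ?_)).aestronglyMeasurable
    intro i
    fin_cases i
    · exact C.measurable_condCDF 0 (u 0)
    · exact C.measurable_condCDF 1 (u 1)
  · exact .of_forall fun t => by rw [Real.norm_of_nonneg (h0 _)]; exact h1 _
  · intro v
    rw [← hA, C.apply_eq]
    congr 1
    ext x
    simp [Pi.le_def, Fin.forall_fin_succ, Fin.last, and_assoc]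

/-- The inequality that passes to total variation limits of simplified copulas. -/
theorem IsGeneralizedSimplified.ae_abs_kernel_sub_le {C : Copula 3}
    (hC : C.IsGeneralizedSimplified) (u v : Fin 2 → I) : ∀ᵐ p : I × I,
      |(C.kernel p.1).real (Iic u) - (C.kernel p.2).real (Iic v)| ≤
        ∑ i, |(C.condCDF i (u i) p.1 : ℝ) - C.condCDF i (v i) p.2| := by
  obtain ⟨A, hA⟩ := hC.exists_copula
  filter_upwards [Measure.quasiMeasurePreserving_fst.ae (hA u),
    Measure.quasiMeasurePreserving_snd.ae (hA v)] with p h1 h2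
  rw [h1, h2]
  simpa [Fin.sum_univ_two] using A.abs_sub_le_sum_abs
    ![C.condCDF 0 (u 0) p.1, C.condCDF 1 (u 1) p.1] ![C.condCDF 0 (v 0) p.2, C.condCDF 1 (v 1) p.2]

theorem ae_abs_kernel_sub_le_of_mem_closure {D : Copula 3}
    (hD : D ∈ closure {C : Copula 3 | C.IsSimplified}) (u v : Fin 2 → I) : ∀ᵐ p : I × I,
      |(D.kernel p.1).real (Iic u) - (D.kernel p.2).real (Iic v)| ≤
        ∑ i, |(D.condCDF i (u i) p.1 : ℝ) - D.condCDF i (v i) p.2| := by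
  have hm : ∀ (i : Fin 2) (w : I), MeasurableSet {x : Fin 2 → I | x i ≤ w} := fun i w =>
    measurableSet_le (measurable_pi_apply i) measurable_const
  have hK : ∀ w : Fin 2 → I, Integrable fun t => (D.kernel t).real (Iic w) := fun w =>
    D.integrable_kernel_real measurableSet_Iic
  have hF : ∀ (i : Fin 2) (w : I), Integrable fun t => (D.condCDF i w t : ℝ) := fun i w =>
    D.integrable_kernel_real (hm i w)
  -- `ψ` is the amount by which the inequality fails; the claim is that its integral vanishes.
  set ψ : I × I → ℝ := fun p => max 0
    (|(D.kernel p.1).real (Iic u) - (D.kernel p.2).real (Iic v)| -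
        ∑ i, |(D.condCDF i (u i) p.1 : ℝ) - D.condCDF i (v i) p.2|) with hψ
  have hψi : Integrable ψ := by
    refine (integrable_zero _ _ _).sup (Integrable.sub ?_ (integrable_finsetSum _ fun i _ => ?_))
    · exact (((hK u).comp_fst volume).sub ((hK v).comp_snd volume)).abs
    · exact (((hF i (u i)).comp_fst volume).sub ((hF i (v i)).comp_snd volume)).abs
  have hψ0 : ∀ p, 0 ≤ ψ p := fun p => le_max_left _ _
  -- Passing from `D` to `C` changes two joint and four marginal kernel values, each at an `L¹` cost
  -- of at most `2 * dist D C`.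
  have hbound : ∀ C : Copula 3, C.IsSimplified → ∫ p, ψ p ≤ 12 * dist D C := by
    intro C hC
    let e : Set (Fin 2 → I) → I → ℝ := fun R t => |(D.kernel t).real R - (C.kernel t).real R|
    have he : ∀ R, MeasurableSet R → Integrable (e R) := fun R hR =>
      ((D.integrable_kernel_real hR).sub (C.integrable_kernel_real hR)).abs
    have he1 : ∀ R, MeasurableSet R → Integrable fun p : I × I => e R p.1 := fun R hR =>
      (he R hR).comp_fst volume
    have he2 : ∀ R, MeasurableSet R → Integrable fun p : I × I => e R p.2 := fun R hR =>
      (he R hR).comp_snd volume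
    have hi1 : ∀ R, MeasurableSet R → ∫ p : I × I, e R p.1 ≤ 2 * dist D C := fun R hR => by
      rw [Measure.volume_eq_prod, integral_fun_fst]
      simpa using D.integral_abs_kernel_real_sub_le C hR
    have hi2 : ∀ R, MeasurableSet R → ∫ p : I × I, e R p.2 ≤ 2 * dist D C := fun R hR => by
      rw [Measure.volume_eq_prod, integral_fun_snd]
      simpa using D.integral_abs_kernel_real_sub_le C hR
    have hs : ∀ i : Fin 2, Integrable fun p : I × I =>
        e {x | x i ≤ u i} p.1 + e {x | x i ≤ v i} p.2 := fun i =>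
      (he1 _ (hm i _)).add (he2 _ (hm i _))
    have hK1 := he1 (Iic u) measurableSet_Iic
    have hK2 := he2 (Iic v) measurableSet_Iic
    have hK12 : Integrable fun p : I × I => e (Iic u) p.1 + e (Iic v) p.2 := hK1.add hK2
    have hle : ∫ p, ψ p ≤ ∫ p : I × I, (e (Iic u) p.1 + e (Iic v) p.2) +
        ∑ i, (e {x | x i ≤ u i} p.1 + e {x | x i ≤ v i} p.2) := by
      refine integral_mono_ae hψi (hK12.add (integrable_finsetSum _ fun i _ => hs i)) ?_
      filter_upwards [hC.1.ae_abs_kernel_sub_le u v] with p hp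
      have hnn : ∀ R t, 0 ≤ e R t := fun R t => abs_nonneg _
      refine max_le (add_nonneg (add_nonneg (hnn _ _) (hnn _ _))
        (Finset.sum_nonneg fun i _ => add_nonneg (hnn _ _) (hnn _ _))) ?_
      have tri : ∀ a b a' b' : ℝ, |a - b| ≤ |a' - b'| + (|a - a'| + |b - b'|) := by
        intro a b a' b'
        have h1 := abs_sub_le a a' b
        have h2 := abs_sub_le a' b' b
        rw [abs_sub_comm b' b] at h2
        linarith
      have t1 := tri ((D.kernel p.1).real (Iic u)) ((D.kernel p.2).real (Iic v))
        ((C.kernel p.1).real (Iic u)) ((C.kernel p.2).real (Iic v))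
      have t2 : ∑ i, |(C.condCDF i (u i) p.1 : ℝ) - C.condCDF i (v i) p.2| ≤
          ∑ i, (|(D.condCDF i (u i) p.1 : ℝ) - D.condCDF i (v i) p.2| +
            (e {x | x i ≤ u i} p.1 + e {x | x i ≤ v i} p.2)) := by
        refine Finset.sum_le_sum fun i _ => ?_
        have := tri (C.condCDF i (u i) p.1 : ℝ) (C.condCDF i (v i) p.2)
          (D.condCDF i (u i) p.1 : ℝ) (D.condCDF i (v i) p.2)
        rw [abs_sub_comm (C.condCDF i (u i) p.1 : ℝ) (D.condCDF i (u i) p.1),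
          abs_sub_comm (C.condCDF i (v i) p.2 : ℝ) (D.condCDF i (v i) p.2)] at this
        exact this
      rw [Finset.sum_add_distrib] at t2
      simp only [e] at t2 ⊢
      linarith
    rw [integral_add hK12 (integrable_finsetSum _ fun i _ => hs i),
      integral_add hK1 hK2, integral_finsetSum _ fun i _ => hs i, Fin.sum_univ_two,
      integral_add (he1 _ (hm 0 _)) (he2 _ (hm 0 _)),
      integral_add (he1 _ (hm 1 _)) (he2 _ (hm 1 _))] at hle
    linarith [hi1 _ (measurableSet_Iic (a := u)), hi2 _ (measurableSet_Iic (a := v)),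
      hi1 _ (hm 0 (u 0)), hi2 _ (hm 0 (v 0)), hi1 _ (hm 1 (u 1)), hi2 _ (hm 1 (v 1))]
  have hzero : ∫ p, ψ p = 0 := by
    refine le_antisymm (le_of_forall_pos_le_add fun ε hε => ?_) (integral_nonneg hψ0)
    obtain ⟨C, hC, hdist⟩ := Metric.mem_closure_iff.1 hD (ε / 12) (by positivity)
    linarith [hbound C hC]
  filter_upwards [(integral_eq_zero_iff_of_nonneg hψ0 hψi).1 hzero] with p hp
  have := (le_max_right _ _).trans_eq hp
  simpa using this

/-! ### Convex combinations -/

section mix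

variable {d : ℕ}

/-- The convex combination `(1 - δ) μ_C + δ μ_D`. -/
noncomputable def mixMeasure (C D : Copula d) (δ : I) : Measure (Fin d → I) :=
  ENNReal.ofReal (1 - δ) • C.measure + ENNReal.ofReal δ • D.measure

theorem ofReal_one_sub_add_ofReal (δ : I) : ENNReal.ofReal (1 - δ) + ENNReal.ofReal δ = 1 := by
  rw [← ENNReal.ofReal_add (sub_nonneg.2 δ.2.2) δ.2.1]; simp

instance (C D : Copula d) (δ : I) : IsProbabilityMeasure (mixMeasure C D δ) :=
  ⟨by simpa [mixMeasure] using ofReal_one_sub_add_ofReal δ⟩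

theorem mixMeasure_real_apply (C D : Copula d) (δ : I) (G : Set (Fin d → I)) :
    (mixMeasure C D δ).real G = (1 - δ) * C.measure.real G + δ * D.measure.real G := by
  rw [mixMeasure, measureReal_add_apply
    (ENNReal.mul_ne_top ENNReal.ofReal_ne_top (measure_ne_top _ _))
    (ENNReal.mul_ne_top ENNReal.ofReal_ne_top (measure_ne_top _ _)),
    measureReal_ennreal_smul_apply, measureReal_ennreal_smul_apply,
    ENNReal.toReal_ofReal (sub_nonneg.2 δ.2.2), ENNReal.toReal_ofReal δ.2.1]

/-- The convex combination `(1 - δ) C + δ D` of two copulas. -/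
noncomputable def mix (C D : Copula d) (δ : I) : Copula d where
  toFun u := (mixMeasure C D δ).real (Iic u)
  exists_measure := by
    refine ⟨mixMeasure C D δ, inferInstance, fun i => ?_, fun u => rfl⟩
    rw [mixMeasure, Measure.map_add _ _ (measurable_pi_apply i), Measure.map_smul,
      Measure.map_smul, C.map_measure, D.map_measure, ← add_smul, ofReal_one_sub_add_ofReal,
      one_smul]

theorem measure_mix (C D : Copula d) (δ : I) : (C.mix D δ).measure = mixMeasure C D δ :=
  measure_eq _ _ fun _ => rfl

theorem measureReal_mix (C D : Copula d) (δ : I) (G : Set (Fin d → I)) :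
    (C.mix D δ).measure.real G = (1 - δ) * C.measure.real G + δ * D.measure.real G := by
  rw [measure_mix, mixMeasure_real_apply]

theorem dist_mix_le (C D : Copula d) (δ : I) : dist (C.mix D δ) C ≤ δ := by
  have : Nonempty {G : Set (Fin d → I) // MeasurableSet G} := ⟨⟨∅, MeasurableSet.empty⟩⟩
  refine ciSup_le fun G => ?_
  rw [measureReal_mix, show (1 - (δ : ℝ)) * C.measure.real G + δ * D.measure.real G -
    C.measure.real G = δ * (D.measure.real G - C.measure.real G) by ring, abs_mul,
    abs_of_nonneg δ.2.1]
  refine mul_le_of_le_one_right δ.2.1 (abs_le.2 ⟨?_, ?_⟩) <;>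
  linarith [measureReal_nonneg (μ := C.measure) (s := G.1),
    measureReal_nonneg (μ := D.measure) (s := G.1),
    measureReal_le_one (μ := C.measure) (s := G.1), measureReal_le_one (μ := D.measure) (s := G.1)]

theorem kernel_mix (C D : Copula (d + 1)) (δ : I) {R : Set (Fin d → I)} (hR : MeasurableSet R) :
    ∀ᵐ t : I, ((C.mix D δ).kernel t).real R =
      (1 - δ) * (C.kernel t).real R + δ * (D.kernel t).real R := by
  have hC := C.integrable_kernel_real hR
  have hD := D.integrable_kernel_real hR
  refine kernel_real_ae_eq _ hR ((hC.const_mul _).add (hD.const_mul _)) (fun t => ?_) fun v => ?_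
  · exact add_nonneg (mul_nonneg (sub_nonneg.2 δ.2.2) measureReal_nonneg)
      (mul_nonneg δ.2.1 measureReal_nonneg)
  · rw [measureReal_mix, integral_add (hC.const_mul _).integrableOn (hD.const_mul _).integrableOn,
      integral_const_mul, integral_const_mul, C.setIntegral_kernel_real hR measurableSet_Iic,
      D.setIntegral_kernel_real hR measurableSet_Iic]
    rfl

/-- As `δ < 1`, the positive density of `C` keeps a positive weight, so the density of `D` need only
be nonnegative. -/
theorem HasPositiveDensity.mix {C D : Copula d} (hC : C.HasPositiveDensity) {δ : I}
    (hδ : (δ : ℝ) < 1) {e : (Fin d → I) → ℝ} (he : Measurable e) (he0 : ∀ x, 0 ≤ e x)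
    (hD : D.measure = volume.withDensity fun x => ENNReal.ofReal (e x)) :
    (C.mix D δ).HasPositiveDensity := by
  obtain ⟨c, hcm, hc0, hc⟩ := hC
  refine ⟨fun x => (1 - δ) * c x + δ * e x, (hcm.const_mul _).add (he.const_mul _), ?_, ?_⟩
  · filter_upwards [hc0] with x hx
    exact add_pos_of_pos_of_nonneg (mul_pos (sub_pos.2 hδ) hx) (mul_nonneg δ.2.1 (he0 x))
  · rw [measure_mix, mixMeasure, hc, hD, ← withDensity_smul _ hcm.ennreal_ofReal,
      ← withDensity_smul _ he.ennreal_ofReal,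
      ← withDensity_add_left (hcm.ennreal_ofReal.const_smul _)]
    refine withDensity_congr_ae ?_
    filter_upwards [hc0] with x hx
    simp only [Pi.add_apply, Pi.smul_apply, smul_eq_mul]
    rw [ENNReal.ofReal_add (mul_nonneg (sub_nonneg.2 δ.2.2) hx.le) (mul_nonneg δ.2.1 (he0 x)),
      ENNReal.ofReal_mul (sub_nonneg.2 δ.2.2), ENNReal.ofReal_mul δ.2.1]

end mix

end Copula

/-! ### Block copulas: uniform conditional margins, prescribed dependence -/

/-- The midpoint of the unit interval. -/
noncomputable def halfPoint : I := ⟨1 / 2, by norm_num, by norm_num⟩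

/-- The function on the unit interval that is `1` on `[0, 1/2]` and `-1` on `(1/2, 1]`. -/
noncomputable def halfSign (x : I) : ℝ := if x ≤ halfPoint then 1 else -1

theorem measurable_halfSign : Measurable halfSign :=
  Measurable.ite measurableSet_Iic measurable_const measurable_const

theorem abs_halfSign (x : I) : |halfSign x| = 1 := by
  unfold halfSign; split_ifs <;> simp

theorem integrable_halfSign : Integrable halfSign :=
  .of_bound measurable_halfSign.aestronglyMeasurable 1 (.of_forall fun x => (abs_halfSign x).le)

theorem setIntegral_Iic_halfPoint_halfSign : ∫ x in Iic halfPoint, halfSign x = 1 / 2 := by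
  rw [setIntegral_congr_fun (f := halfSign) (g := fun _ => (1 : ℝ)) measurableSet_Iic fun x hx =>
    if_pos hx]
  simp [measureReal_def, volume_Iic, halfPoint]

theorem integral_halfSign : ∫ x, halfSign x = 0 := by
  rw [← integral_add_compl (measurableSet_Iic (a := halfPoint)) integrable_halfSign,
    setIntegral_Iic_halfPoint_halfSign, setIntegral_congr_fun (f := halfSign) (g := fun _ => (-1 : ℝ))
      measurableSet_Iic.compl fun x hx => if_neg hx]
  simp only [compl_Iic, integral_const, measureReal_restrict_apply_univ, smul_eq_mul]
  rw [measureReal_def, volume_Ioi]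
  norm_num [halfPoint]

theorem abs_setIntegral_halfSign_le (B : Set I) : |∫ x in B, halfSign x| ≤ volume.real B := by
  simpa using norm_setIntegral_le_of_norm_le_const (f := halfSign) (s := B) (C := 1)
    (measure_lt_top volume B) fun x _ => (abs_halfSign x).le

namespace Copula

/-- A density on the cube whose conditional margins given the last coordinate are uniform, and
whose conditional dependence given `x 2 = t` has strength `h t`. -/
noncomputable def blockDensity (h : I → I) (x : Fin 3 → I) : ℝ :=
  1 + halfSign (x 0) * halfSign (x 1) * h (x 2)

theorem measurable_blockDensity {h : I → I} (hm : Measurable h) : Measurable (blockDensity h) := by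
  have := measurable_halfSign
  unfold blockDensity
  fun_prop

theorem abs_blockTerm_le {h : I → I} (x : Fin 3 → I) :
    |halfSign (x 0) * halfSign (x 1) * h (x 2)| ≤ 1 := by
  rw [abs_mul, abs_mul, abs_halfSign, abs_halfSign, abs_of_nonneg (h (x 2)).2.1]
  simpa using (h (x 2)).2.2

theorem blockDensity_nonneg {h : I → I} (x : Fin 3 → I) : 0 ≤ blockDensity h x := by
  have := (abs_le.1 (abs_blockTerm_le (h := h) x)).1
  unfold blockDensity
  linarith

theorem integrable_blockDensity {h : I → I} (hm : Measurable h) : Integrable (blockDensity h) := by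
  refine .of_bound (measurable_blockDensity hm).aestronglyMeasurable 2 (.of_forall fun x => ?_)
  rw [Real.norm_of_nonneg (blockDensity_nonneg x)]
  have := (abs_le.1 (abs_blockTerm_le (h := h) x)).2
  unfold blockDensity
  linarith

/-- Both terms of the density are products of functions of one coordinate. As `halfSign` has
integral zero, the second term disappears when `B 0` or `B 1` is the whole interval, which makes the
margins uniform. -/
theorem setIntegral_blockDensity {h : I → I} (hm : Measurable h) (B : Fin 3 → Set I) :
    ∫ x in Set.pi univ B, blockDensity h x =
      volume.real (B 0) * volume.real (B 1) * volume.real (B 2) +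
        (∫ x in B 0, halfSign x) * (∫ x in B 1, halfSign x) * ∫ t in B 2, (h t : ℝ) := by
  have hi : Integrable fun x : Fin 3 → I => halfSign (x 0) * halfSign (x 1) * h (x 2) := by
    have := measurable_halfSign
    exact .of_bound (by fun_prop : Measurable _).aestronglyMeasurable 1
      (.of_forall fun x => abs_blockTerm_le x)
  have hp := integral_fintype_prod_eq_prod (𝕜 := ℝ)
    (![halfSign, halfSign, fun t => (h t : ℝ)] : Fin 3 → I → ℝ)
    (μ := fun i => volume.restrict (B i))
  rw [← Measure.restrict_pi_pi] at hp
  simp only [Fin.prod_univ_three] at hp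
  simp only [blockDensity]
  rw [integral_add (integrable_const _).integrableOn hi.integrableOn]
  congr 1
  simp [measureReal_def, volume_pi_pi, Fin.prod_univ_three]

/-- The measure on the cube with density `blockDensity h`. -/
noncomputable def blockMeasure (h : I → I) : Measure (Fin 3 → I) :=
  volume.withDensity fun x => ENNReal.ofReal (blockDensity h x)

theorem blockMeasure_pi {h : I → I} (hm : Measurable h) {B : Fin 3 → Set I}
    (hB : ∀ i, MeasurableSet (B i)) :
    blockMeasure h (Set.pi univ B) = ENNReal.ofReal
      (volume.real (B 0) * volume.real (B 1) * volume.real (B 2) +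
        (∫ x in B 0, halfSign x) * (∫ x in B 1, halfSign x) * ∫ t in B 2, (h t : ℝ)) := by
  rw [blockMeasure, withDensity_apply _ (.univ_pi hB),
    ← ofReal_integral_eq_lintegral_ofReal (integrable_blockDensity hm).integrableOn
      (.of_forall blockDensity_nonneg), setIntegral_blockDensity hm]

theorem isProbabilityMeasure_blockMeasure {h : I → I} (hm : Measurable h) :
    IsProbabilityMeasure (blockMeasure h) := by
  refine ⟨?_⟩
  rw [← Set.pi_univ univ, blockMeasure_pi hm fun _ => .univ]
  simp [integral_halfSign]

theorem map_blockMeasure {h : I → I} (hm : Measurable h) (i : Fin 3) :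
    (blockMeasure h).map (fun x => x i) = volume := by
  ext B hB
  rw [Measure.map_apply (measurable_pi_apply i) hB]
  have hset : (fun x : Fin 3 → I => x i) ⁻¹' B =
      Set.pi univ (Function.update (fun _ => univ) i B) := by
    ext x
    simp [Function.update_apply]
  rw [hset, blockMeasure_pi hm]
  · fin_cases i <;> simp [integral_halfSign]
  · intro j
    rcases eq_or_ne j i with rfl | hj
    · simpa using hB
    · simp [hj]

/-- The copula with density `blockDensity h`. -/
noncomputable def block (h : I → I) (hm : Measurable h) : Copula 3 where
  toFun u := (blockMeasure h).real (Iic u)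
  exists_measure := ⟨blockMeasure h, isProbabilityMeasure_blockMeasure hm,
    map_blockMeasure hm, fun _ => rfl⟩

theorem measure_block {h : I → I} (hm : Measurable h) : (block h hm).measure = blockMeasure h :=
  have := isProbabilityMeasure_blockMeasure hm
  measure_eq _ _ fun _ => rfl

theorem kernel_block {h : I → I} (hm : Measurable h) {B : Fin 2 → Set I}
    (hB : ∀ i, MeasurableSet (B i)) :
    ∀ᵐ t : I, ((block h hm).kernel t).real (Set.pi univ B) =
      volume.real (B 0) * volume.real (B 1) +
        (∫ x in B 0, halfSign x) * (∫ x in B 1, halfSign x) * h t := by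
  -- This bound gives the nonnegativity of the candidate kernel value for every `t`, as required to
  -- identify it through its integrals.
  have hb : |(∫ x in B 0, halfSign x) * (∫ x in B 1, halfSign x)| ≤
      volume.real (B 0) * volume.real (B 1) := by
    rw [abs_mul]
    exact mul_le_mul (abs_setIntegral_halfSign_le _) (abs_setIntegral_halfSign_le _)
      (abs_nonneg _) measureReal_nonneg
  have hhi : Integrable fun t => (h t : ℝ) :=
    .of_bound hm.subtype_val.aestronglyMeasurable 1
      (.of_forall fun t => by rw [Real.norm_of_nonneg (h t).2.1]; exact (h t).2.2)
  have hnn : ∀ t, 0 ≤ volume.real (B 0) * volume.real (B 1) +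
      (∫ x in B 0, halfSign x) * (∫ x in B 1, halfSign x) * h t := by
    intro t
    have h1 := mul_le_mul_of_nonneg_right hb (h t).2.1
    have h2 : volume.real (B 0) * volume.real (B 1) * h t ≤
        volume.real (B 0) * volume.real (B 1) :=
      mul_le_of_le_one_right (by positivity) (h t).2.2
    rw [← abs_of_nonneg (h t).2.1, ← abs_mul, abs_of_nonneg (h t).2.1] at h1
    linarith [neg_abs_le ((∫ x in B 0, halfSign x) * (∫ x in B 1, halfSign x) * h t)]
  refine kernel_real_ae_eq _ (.univ_pi hB) ((integrable_const _).add (hhi.const_mul _)) hnn ?_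
  intro v
  have hset : {x : Fin 3 → I | (fun i : Fin 2 => x i.castSucc) ∈ Set.pi univ B ∧
      x (Fin.last 2) ≤ v} = Set.pi univ ![B 0, B 1, Iic v] := by
    ext x
    simp [Set.mem_pi, Fin.forall_fin_succ, Fin.last, and_assoc]
  rw [hset, measure_block hm, measureReal_def, blockMeasure_pi hm, ENNReal.toReal_ofReal,
    integral_add (integrable_const _) (hhi.const_mul _).integrableOn]
  · simp only [integral_const, measureReal_restrict_apply_univ, smul_eq_mul, Matrix.cons_val,
      integral_const_mul]
    ring
  · rw [← setIntegral_blockDensity hm]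
    exact integral_nonneg blockDensity_nonneg
  · intro i; fin_cases i
    exacts [hB 0, hB 1, measurableSet_Iic]

end Copula

/-! ### Perturbing a simplified copula out of the closure -/

namespace Copula

theorem condCDF_block {h : I → I} (hm : Measurable h) (i : Fin 2) (u : I) :
    ∀ᵐ t : I, ((block h hm).condCDF i u t : ℝ) = u := by
  have hset : {x : Fin 2 → I | x i ≤ u} =
      Set.pi univ (Function.update (fun _ => univ) i (Iic u)) := by
    ext x
    simp [Function.update_apply]
  have hB : ∀ j, MeasurableSet (Function.update (fun _ : Fin 2 => (univ : Set I)) i (Iic u) j) := by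
    intro j
    rcases eq_or_ne j i with rfl | hj
    · simp
    · simp [hj]
  filter_upwards [kernel_block hm hB] with t ht
  change ((block h hm).kernel t).real {x : Fin 2 → I | x i ≤ u} = u
  rw [hset, ht]
  fin_cases i <;> simp [integral_halfSign, measureReal_def, volume_Iic, u.2.1]

theorem kernel_block_Iic {h : I → I} (hm : Measurable h) (u : Fin 2 → I) :
    ∀ᵐ t : I, ((block h hm).kernel t).real (Iic u) = (u 0 : ℝ) * u 1 +
      (∫ x in Iic (u 0), halfSign x) * (∫ x in Iic (u 1), halfSign x) * h t := by
  filter_upwards [kernel_block hm fun i => measurableSet_Iic (a := u i)] with t ht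
  rw [Set.pi_univ_Iic] at ht
  rw [ht]
  simp [measureReal_def, volume_Iic, (u _).2.1]

theorem condCDF_mix_block (C : Copula 3) {h : I → I} (hm : Measurable h) (δ : I) (i : Fin 2)
    (u : I) : ∀ᵐ t : I, ((C.mix (block h hm) δ).condCDF i u t : ℝ) =
      (1 - δ) * C.condCDF i u t + δ * u := by
  filter_upwards [condCDF_block hm i u, C.kernel_mix (block h hm) δ
    (measurableSet_le (measurable_pi_apply i) (measurable_const (a := u)))] with t h1 h2
  rw [← h1]
  exact h2

theorem kernel_mix_block (C : Copula 3) {h : I → I} (hm : Measurable h) (δ : I) (u : Fin 2 → I) :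
    ∀ᵐ t : I, ((C.mix (block h hm) δ).kernel t).real (Iic u) =
      (1 - δ) * (C.kernel t).real (Iic u) + δ * ((u 0 : ℝ) * u 1 +
        (∫ x in Iic (u 0), halfSign x) * (∫ x in Iic (u 1), halfSign x) * h t) := by
  filter_upwards [kernel_block_Iic hm u, C.kernel_mix (block h hm) δ
    (measurableSet_Iic (a := u))] with t h1 h2
  rw [h2, h1]

/-- The face `x i = 0` is a null set because the margin is uniform. This supplies the left endpoint
for the intermediate value theorem. -/
theorem condCDF_zero (C : Copula 3) (i : Fin 2) : ∀ᵐ t : I, (C.condCDF i 0 t : ℝ) = 0 := by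
  refine C.kernel_real_ae_eq (R := {x | x i ≤ 0})
    (measurableSet_le (measurable_pi_apply i) measurable_const) (integrable_zero _ _ _)
    (fun _ => le_rfl) fun v => ?_
  rw [integral_zero]
  refine le_antisymm (le_trans (measureReal_mono (s₂ := (fun x : Fin 3 → I => x i.castSucc) ⁻¹'
    Iic 0) fun x hx => And.left hx) ?_) measureReal_nonneg
  rw [← map_measureReal_apply (measurable_pi_apply _) measurableSet_Iic, C.map_measure,
    measureReal_def, volume_Iic]
  simp

theorem condCDF_one (C : Copula 3) (i : Fin 2) (t : I) : (C.condCDF i 1 t : ℝ) = 1 := by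
  have : {x : Fin 2 → I | x i ≤ 1} = univ := eq_univ_of_forall fun x => le_one'
  simp [condCDF, this]

/-- If `C` has continuous conditional margins, then perturbations of `C` towards copulas with
uniform conditional margins cannot all be limits of simplified copulas. -/
theorem exists_mix_block_notMem_closure {C : Copula 3} (hC : C.HasContinuousCondMargins) {δ : I}
    (hδ : 0 < (δ : ℝ)) : ∃ (h : I → I) (hm : Measurable h),
      C.mix (block h hm) δ ∉ closure {C : Copula 3 | C.IsSimplified} := by
  by_contra! hcl
  obtain ⟨Q, hQc, hQd⟩ := TopologicalSpace.exists_countable_dense I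
  let h₀ : I → I := fun _ => 0
  let h₁ : I → I := fun t => if t ≤ halfPoint then 0 else 1
  have hm₀ : Measurable h₀ := measurable_const
  have hm₁ : Measurable h₁ := Measurable.ite measurableSet_Iic measurable_const measurable_const
  let m : Fin 2 → I := fun _ => halfPoint
  -- The conditional margins of the mixture, independent of `h`.
  let Φ : Fin 2 → I → I → ℝ := fun i t u => (1 - δ) * C.condCDF i u t + δ * u
  -- The consequences of `hcl` for one perturbation.
  have key : ∀ (h : I → I), Measurable h → ∀ᵐ p : I × I, ∀ a ∈ Q, ∀ b ∈ Q,
      |((1 - δ) * (C.kernel p.1).real (Iic ![a, b]) + δ * ((a : ℝ) * b +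
          (∫ x in Iic a, halfSign x) * (∫ x in Iic b, halfSign x) * h p.1)) -
        ((1 - δ) * (C.kernel p.2).real (Iic m) + δ * (1 / 4 + 1 / 4 * h p.2))| ≤
      |Φ 0 p.1 a - Φ 0 p.2 halfPoint| + |Φ 1 p.1 b - Φ 1 p.2 halfPoint| := by
    intro h hm
    -- The points `a`, `b` will be chosen after `(t, s)`, so one null set must serve all of them;
    -- hence the restriction to the countable set `Q`.
    rw [ae_ball_iff hQc]
    intro a ha
    rw [ae_ball_iff hQc]
    intro b hb
    have fst := fun {P : I → Prop} (hP : ∀ᵐ t, P t) =>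
      Measure.quasiMeasurePreserving_fst (μ := (volume : Measure I))
        (ν := (volume : Measure I)) |>.ae hP
    have snd := fun {P : I → Prop} (hP : ∀ᵐ t, P t) =>
      Measure.quasiMeasurePreserving_snd (μ := (volume : Measure I))
        (ν := (volume : Measure I)) |>.ae hP
    filter_upwards [ae_abs_kernel_sub_le_of_mem_closure (hcl h hm) ![a, b] m,
      fst (C.kernel_mix_block hm δ ![a, b]), snd (C.kernel_mix_block hm δ m),
      fst (C.condCDF_mix_block hm δ 0 a), fst (C.condCDF_mix_block hm δ 1 b),
      snd (C.condCDF_mix_block hm δ 0 halfPoint),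
      snd (C.condCDF_mix_block hm δ 1 halfPoint)] with p hp h1 h2 h3 h4 h5 h6
    rw [h1, h2, Fin.sum_univ_two] at hp
    simp only [m, Matrix.cons_val_zero, Matrix.cons_val_one, h3, h4, h5, h6,
      setIntegral_Iic_halfPoint_halfSign] at hp
    have hq : (halfPoint : ℝ) * halfPoint + 1 / 2 * (1 / 2) * h p.2 = 1 / 4 + 1 / 4 * h p.2 := by
      norm_num [halfPoint]
    rw [hq] at hp
    exact hp
  have hcont : ∀ᵐ t : I, ∀ i, Continuous (Φ i t) := by
    filter_upwards [hC] with t ht i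
    exact (continuous_const.mul (continuous_subtype_val.comp (ht i))).add
      (continuous_const.mul continuous_subtype_val)
  -- On this rectangle `h₁ t = 0` and `h₁ s = 1`. It has positive measure, so it contains a pair
  -- satisfying all the almost sure conditions.
  have hne : (volume : Measure (I × I)) (Iic halfPoint ×ˢ Ioi halfPoint) ≠ 0 := by
    rw [Measure.volume_eq_prod, Measure.prod_prod, volume_Iic, volume_Ioi]
    simp only [halfPoint, ne_eq, mul_eq_zero, ENNReal.ofReal_eq_zero]
    norm_num
  obtain ⟨⟨t, s⟩, ⟨ht, hs⟩, hp₀, hp₁, hΦt, hz⟩ :=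
    Measure.exists_mem_of_measure_ne_zero_of_ae hne (ae_restrict_of_ae
      ((key h₀ hm₀).and ((key h₁ hm₁).and
        ((Measure.quasiMeasurePreserving_fst.ae hcont).and
          (Measure.quasiMeasurePreserving_fst.ae (ae_all_iff.2 C.condCDF_zero))))))
  simp only at hp₀ hp₁ hΦt hz
  -- `Φ i t` is continuous and runs from `0` to `1`, so it attains the value `Φ i s halfPoint`;
  -- density of `Q` then gives an approximate solution in `Q`.
  have hex : ∀ i, ∃ a ∈ Q, |Φ i t a - Φ i s halfPoint| < δ / 16 := by
    intro i
    have h0 : Φ i t 0 = 0 := by simp [Φ, hz i]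
    have h1 : Φ i t 1 = 1 := by simp [Φ, C.condCDF_one]
    have hlo : 0 ≤ Φ i s halfPoint := add_nonneg
      (mul_nonneg (sub_nonneg.2 δ.2.2) (C.condCDF i halfPoint s).2.1)
      (mul_nonneg δ.2.1 halfPoint.2.1)
    have hhi : Φ i s halfPoint ≤ 1 := by
      have e1 := mul_le_of_le_one_right (sub_nonneg.2 δ.2.2) (C.condCDF i halfPoint s).2.2
      have e2 := mul_le_of_le_one_right δ.2.1 halfPoint.2.2
      simp only [Φ]
      linarith
    obtain ⟨u, hu⟩ := mem_range_of_exists_le_of_exists_ge (hΦt i) ⟨0, h0.trans_le hlo⟩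
      ⟨1, hhi.trans_eq h1.symm⟩
    have hopen : IsOpen {a | |Φ i t a - Φ i s halfPoint| < δ / 16} :=
      isOpen_lt (((hΦt i).sub continuous_const).abs) continuous_const
    obtain ⟨a, haQ, ha⟩ := hQd.exists_mem_open hopen ⟨u, by simpa [hu] using hδ⟩
    exact ⟨a, haQ, ha⟩
  obtain ⟨a, ha, ha'⟩ := hex 0
  obtain ⟨b, hb, hb'⟩ := hex 1
  have e₀ := abs_le.1 (hp₀ a ha b hb)
  have e₁ := abs_le.1 (hp₁ a ha b hb)
  have v₁ : h₁ t = 0 := if_pos ht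
  have v₂ : h₁ s = 1 := if_neg (not_le.2 hs)
  rw [v₁, v₂] at e₁
  simp only [h₀, Icc.coe_zero, Icc.coe_one, mul_zero, add_zero, mul_one] at e₀ e₁
  -- Both left-hand sides are below `δ/16 + δ/16 = δ/8`, yet the quantities inside the absolute
  -- values differ by exactly `δ/4`.
  linarith [e₀.1, e₀.2, e₁.1, e₁.2]

end Copula

/-! ### Conclusion -/

theorem theorem3p6 :
    IsNowhereDense {C : Copula 3 | C.IsSimplified} ∧
      IsNowhereDense {C : {C : Copula 3 // C.HasPositiveDensity} | C.1.IsSimplified} := by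
  have small : ∀ ε > (0 : ℝ), ∃ δ : I, 0 < (δ : ℝ) ∧ (δ : ℝ) < 1 ∧ (δ : ℝ) < ε := fun ε hε => by
    have h2 : 0 < min (1 / 2) (ε / 2) := by positivity
    refine ⟨⟨min (1 / 2) (ε / 2), h2.le, (min_le_left _ _).trans (by norm_num)⟩, h2, ?_, ?_⟩
    · exact (min_le_left _ _).trans_lt (by norm_num)
    · exact (min_le_right _ _).trans_lt (by linarith)
  constructor
  · refine eq_empty_of_forall_notMem fun C₀ hC₀ => ?_
    -- A nonempty interior of the closure contains a point of the set itself, so the perturbed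
    -- copula may be taken to have continuous conditional margins.
    obtain ⟨C, hCint, hC⟩ := mem_closure_iff.1 (interior_subset hC₀) _ isOpen_interior hC₀
    obtain ⟨ε, hε, hball⟩ := Metric.isOpen_iff.1 isOpen_interior C hCint
    obtain ⟨δ, hδ0, -, hδε⟩ := small ε hε
    obtain ⟨h, hm, hnot⟩ := Copula.exists_mix_block_notMem_closure hC.2 hδ0
    exact hnot (interior_subset (hball ((C.dist_mix_le _ δ).trans_lt hδε)))
  · refine eq_empty_of_forall_notMem fun C₀ hC₀ => ?_
    obtain ⟨C, hCint, hC⟩ := mem_closure_iff.1 (interior_subset hC₀) _ isOpen_interior hC₀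
    obtain ⟨ε, hε, hball⟩ := Metric.isOpen_iff.1 isOpen_interior C hCint
    obtain ⟨δ, hδ0, hδ1, hδε⟩ := small ε hε
    obtain ⟨h, hm, hnot⟩ := Copula.exists_mix_block_notMem_closure hC.2 hδ0
    have hpos : (C.1.mix (Copula.block h hm) δ).HasPositiveDensity :=
      C.2.mix hδ1 (Copula.measurable_blockDensity hm) Copula.blockDensity_nonneg
        (Copula.measure_block hm)
    have hdist : dist (⟨_, hpos⟩ : {C : Copula 3 // C.HasPositiveDensity}) C < ε :=
      (C.1.dist_mix_le (Copula.block h hm) δ).trans_lt hδε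
    have hmem := interior_subset (hball hdist)
    -- Closure in the subspace maps into closure among all copulas, which the mixture avoids.
    exact hnot (map_mem_closure (f := Subtype.val) continuous_subtype_val hmem fun D hD => hD)
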